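/- Let $0<q<1$ and, for $z\in\mathbb{C}$, let $$E_q(z)=\prod_{k=0}^{\infty}\bigl(1+(1-q)q^k z\bigr),\quad \mathrm{Sin}_q z=\frac{E_q(iz)-E_q(-iz)}{2i},\quad \mathrm{Cos}_q z=\frac{E_q(iz)+E_q(-iz)}{2}.$$ The positive zeros of $\mathrm{Sin}_q$ and of $\mathrm{Cos}_q$ can be listed as infinite strictly increasing sequences $(\xi_n)_{n\ge 1}$ and $(\eta_n)_{n\ge 1}$, respectively, and $\mathrm{Sin}_q'\xi_n\neq 0$, $\mathrm{Cos}_q'\eta_n\neq 0$ for all $n\ge1$. The sequences $$\left(q^{2n}\,\frac{\mathrm{Cos}_q\xi_n}{\mathrm{Sin}_q'\xi_n}\right)_{n\ge 1}\quad\text{and}\quad \left(q^{2n}\,\frac{\mathrm{Sin}_q\eta_n}{\mathrm{Cos}_q'\eta_n}\right)_{n\ge 1}$$ are bounded. Moreover, for every $s\in\mathbb{C}$ with $\operatorname{Re}s>1$, the series $$\sum_{n=1}^{\infty}\frac{\mathrm{Cos}_q\xi_n}{\mathrm{Sin}_q'\xi_n}\,\frac{1}{\xi_n^{s}}\quad\text{and}\quad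 \sum_{n=1}^{\infty}\frac{\mathrm{Sin}_q\eta_n}{\mathrm{Cos}_q'\eta_n}\,\frac{1}{\eta_n^{s}},$$ which define $\zeta_q(s)$ and $-\zeta_q^*(s)$, respectively, converge absolutely. -/

import Mathlib

noncomputable section

/-- The infinite `q`-shifted factorial `(a; q)_∞ = ∏_{k ≥ 0} (1 - a q ^ k)`
(the product converges absolutely for `0 < q < 1`, see `multipliable_qPochInf`). -/
def qPochInf (a : ℂ) (q : ℝ) : ℂ := ∏' k : ℕ, (1 - a * (q : ℂ) ^ k)

theorem multipliable_qPochInf (a : ℂ) {q : ℝ} (h0 : 0 < q) (h1 : q < 1) :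
    Multipliable fun k : ℕ => 1 - a * (q : ℂ) ^ k := by
  have hs : Summable fun k : ℕ => ‖-(a * (q : ℂ) ^ k)‖ := by
    simp only [norm_neg, norm_mul, norm_pow, Complex.norm_real, Real.norm_eq_abs, abs_of_pos h0]
    exact (summable_geometric_of_lt_one h0.le h1).mul_left _
  simpa [sub_eq_add_neg] using multipliable_one_add_of_summable hs

/-- The `q`-exponential function `E_q(z) = (-(1 - q) z; q)_∞`. -/
def qExpE (q : ℝ) (z : ℂ) : ℂ := qPochInf (-(1 - (q : ℂ)) * z) q

/-- Jackson's `q`-sine `Sin_q z = (E_q(iz) - E_q(-iz)) / (2i)`. -/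
def qSin (q : ℝ) (z : ℂ) : ℂ :=
  (qExpE q (Complex.I * z) - qExpE q (-Complex.I * z)) / (2 * Complex.I)

/-- Jackson's `q`-cosine `Cos_q z = (E_q(iz) + E_q(-iz)) / 2`. -/
def qCos (q : ℝ) (z : ℂ) : ℂ :=
  (qExpE q (Complex.I * z) + qExpE q (-Complex.I * z)) / 2

/-- `x 1 < x 2 < x 3 < …` is the list, in increasing order, of all positive zeros of `f`. -/
def IsPosZeroSeq (f : ℂ → ℂ) (x : ℕ+ → ℝ) : Prop :=
  StrictMono x ∧ Set.range x = {t : ℝ | 0 < t ∧ f (t : ℂ) = 0}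

end

/-! ### The phase function: growth and derivative bounds. -/

noncomputable section

/-! For real x, writing each factor of E_q(ix) in polar form gives E_q(ix) = |E_q(ix)| exp(iθ(x))
with θ = `qPhase q`. Hence Sin_q and Cos_q are |E_q(ix)| times sin θ and cos θ, and since θ
increases from 0 to ∞ their positive zeros are the solutions of θ = nπ and θ = (n - 1/2)π. At such
zeros the two quotients are 1/θ' and -1/θ' (`deriv_qSin_of_eq_zero`, `deriv_qCos_of_eq_zero`), and
xθ'(x) is bounded below for x ≥ 1, so they are O(x). Iterating θ(x) = arctan((1-q)x) + θ(qx) shows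
that the n-th zero has exact order q^(-2n). This gives boundedness, and for Re s > 1 a geometric
majorant. -/

theorem Real.abs_arctan_le_abs (y : ℝ) : |Real.arctan y| ≤ |y| := by
  have key : ∀ y : ℝ, 0 ≤ y → Real.arctan y ≤ y := fun y hy => by
    simpa [Real.tan_arctan] using
      Real.le_tan (Real.arctan_nonneg.2 hy) (Real.arctan_lt_pi_div_two y)
  rcases le_total 0 y with h | h
  · rw [abs_of_nonneg h, abs_of_nonneg (Real.arctan_nonneg.2 h)]
    exact key y h
  · rw [abs_of_nonpos h, abs_of_nonpos (Real.arctan_le_zero.2 h), ← Real.arctan_neg]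
    exact key _ (by linarith)

/-- The argument `∑ arctan ((1 - q) q ^ k x)` of `E_q(ix)`. -/
def qPhase (q x : ℝ) : ℝ := ∑' k : ℕ, Real.arctan ((1 - q) * q ^ k * x)

/-- The derivative of `qPhase q` at `x`, as a series. -/
def qPhaseDeriv (q x : ℝ) : ℝ := ∑' k : ℕ, (1 - q) * q ^ k / (1 + ((1 - q) * q ^ k * x) ^ 2)

section

variable {q : ℝ} (hq0 : 0 < q) (hq1 : q < 1)
include hq0 hq1

theorem hasSum_one_sub_mul_pow : HasSum (fun k : ℕ => (1 - q) * q ^ k) 1 := by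
  have h := (hasSum_geometric_of_lt_one hq0.le hq1).mul_left (1 - q)
  rwa [mul_inv_cancel₀ (by linarith)] at h

theorem one_sub_mul_pow_pos (k : ℕ) : 0 < (1 - q) * q ^ k :=
  mul_pos (by linarith) (pow_pos hq0 k)

theorem summable_arctan_qPhase (x : ℝ) :
    Summable fun k : ℕ => Real.arctan ((1 - q) * q ^ k * x) := by
  refine Summable.of_norm_bounded
    ((hasSum_one_sub_mul_pow hq0 hq1).summable.mul_right |x|) fun k => ?_
  have := Real.abs_arctan_le_abs ((1 - q) * q ^ k * x)
  rwa [abs_mul, abs_of_pos (one_sub_mul_pow_pos hq0 hq1 k)] at this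

theorem qPhase_le_self {x : ℝ} (hx : 0 ≤ x) : qPhase q x ≤ x := by
  have h := (hasSum_one_sub_mul_pow hq0 hq1).mul_right x
  rw [one_mul] at h
  refine (summable_arctan_qPhase hq0 hq1 x).tsum_le_of_sum_le ?_
  intro s
  refine le_trans (Finset.sum_le_sum fun k _ => ?_) (sum_le_hasSum s (fun k _ => ?_) h)
  · have := Real.abs_arctan_le_abs ((1 - q) * q ^ k * x)
    rw [abs_of_nonneg (mul_nonneg (one_sub_mul_pow_pos hq0 hq1 k).le hx)] at this
    exact (le_abs_self _).trans this
  · exact mul_nonneg (one_sub_mul_pow_pos hq0 hq1 k).le hx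

theorem qPhase_strictMono : StrictMono (qPhase q) := by
  intro x y hxy
  refine Summable.tsum_lt_tsum (i := 0) (fun k => ?_) ?_ (summable_arctan_qPhase hq0 hq1 x)
    (summable_arctan_qPhase hq0 hq1 y)
  · exact Real.arctan_mono (mul_le_mul_of_nonneg_left hxy.le (one_sub_mul_pow_pos hq0 hq1 k).le)
  · exact Real.arctan_strictMono
      (mul_lt_mul_of_pos_left hxy (one_sub_mul_pow_pos hq0 hq1 0))

omit hq0 hq1 in
theorem qPhase_zero : qPhase q 0 = 0 := by simp [qPhase]

theorem qPhase_pos {x : ℝ} (hx : 0 < x) : 0 < qPhase q x := by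
  have := qPhase_strictMono hq0 hq1 hx
  rwa [qPhase_zero] at this

theorem continuousOn_qPhase (M : ℝ) : ContinuousOn (qPhase q) (Set.Icc 0 M) := by
  refine continuousOn_tsum (u := fun k => (1 - q) * q ^ k * M)
    (fun k => (Real.continuous_arctan.comp (by fun_prop)).continuousOn)
    ((hasSum_one_sub_mul_pow hq0 hq1).summable.mul_right M) fun k x hx => ?_
  have h := Real.abs_arctan_le_abs ((1 - q) * q ^ k * x)
  have hk := (one_sub_mul_pow_pos hq0 hq1 k).le
  rw [abs_of_nonneg (mul_nonneg hk hx.1)] at h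
  exact h.trans (mul_le_mul_of_nonneg_left hx.2 hk)

theorem qPhase_eq_arctan_add (x : ℝ) :
    qPhase q x = Real.arctan ((1 - q) * x) + qPhase q (q * x) := by
  rw [qPhase, (summable_arctan_qPhase hq0 hq1 x).tsum_eq_zero_add, qPhase, pow_zero, mul_one]
  congr 2
  ext k
  congr 1
  ring

theorem qPhase_le_add (m : ℕ) (x : ℝ) :
    qPhase q x ≤ m * (Real.pi / 2) + qPhase q (q ^ m * x) := by
  induction m with
  | zero => simp
  | succ m ih =>
    have h := qPhase_eq_arctan_add hq0 hq1 (q ^ m * x)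
    have h' := Real.arctan_lt_pi_div_two ((1 - q) * (q ^ m * x))
    rw [← mul_assoc q, ← pow_succ'] at h
    push_cast
    linarith

/-- Each of m unfoldings loses π/2 - arctan y = arctan(1/y) ≤ 1/y with y = (1-q)q^j x; these losses
form a geometric sum, dominated by the error term. -/
theorem add_qPhase_le (m : ℕ) {x : ℝ} (hx : 0 < x) :
    m * (Real.pi / 2) + qPhase q (q ^ m * x) ≤
      qPhase q x + q / ((1 - q) ^ 2 * (q ^ m * x)) := by
  have hc : 0 < 1 - q := by linarith
  induction m with
  | zero =>
    have : 0 < q / ((1 - q) ^ 2 * (q ^ 0 * x)) := by positivity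
    simp at this ⊢
    linarith
  | succ m ih =>
    have h := qPhase_eq_arctan_add hq0 hq1 (q ^ m * x)
    have hy : 0 < (1 - q) * (q ^ m * x) := by positivity
    have h1 := Real.arctan_inv_of_pos hy
    have h2 := (le_abs_self _).trans (Real.abs_arctan_le_abs ((1 - q) * (q ^ m * x))⁻¹)
    rw [abs_of_pos (inv_pos.2 hy)] at h2
    rw [← mul_assoc q, ← pow_succ'] at h
    have h3 : q / ((1 - q) ^ 2 * (q ^ (m + 1) * x)) =
        q / ((1 - q) ^ 2 * (q ^ m * x)) + ((1 - q) * (q ^ m * x))⁻¹ := by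
      field_simp
      ring
    rw [h3]
    push_cast
    linarith

theorem exists_qPhase_eq {b : ℝ} (hb : 0 < b) : ∃ x, 0 < x ∧ qPhase q x = b := by
  have hc : 0 < 1 - q := by linarith
  obtain ⟨m, hm⟩ := exists_nat_gt (b + 1)
  -- This X makes the error term of `add_qPhase_le` equal to 1, so the phase at X exceeds m - 1 > b.
  set X : ℝ := q / ((1 - q) ^ 2 * q ^ m) with hX
  have hX0 : 0 < X := by positivity
  have h := add_qPhase_le hq0 hq1 m hX0
  have h1 : q / ((1 - q) ^ 2 * (q ^ m * X)) = 1 := by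
    rw [hX]; field_simp
  have h2 := qPhase_pos hq0 hq1 (x := q ^ m * X) (by positivity)
  have h3 : (m : ℝ) ≤ m * (Real.pi / 2) := by
    have := Real.two_le_pi
    nlinarith [Nat.cast_nonneg (α := ℝ) m]
  obtain ⟨x, hx, hxb⟩ := intermediate_value_Icc hX0.le (continuousOn_qPhase hq0 hq1 X)
    (show b ∈ Set.Icc (qPhase q 0) (qPhase q X) from
      ⟨by rw [qPhase_zero]; exact hb.le, by linarith⟩)
  refine ⟨x, lt_of_le_of_ne hx.1 ?_, hxb⟩
  rintro rfl
  rw [qPhase_zero] at hxb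
  exact hb.ne hxb

theorem summable_qPhaseDeriv (x : ℝ) :
    Summable fun k : ℕ => (1 - q) * q ^ k / (1 + ((1 - q) * q ^ k * x) ^ 2) :=
  Summable.of_nonneg_of_le
    (fun k => div_nonneg (one_sub_mul_pow_pos hq0 hq1 k).le (by positivity))
    (fun k => div_le_self (one_sub_mul_pow_pos hq0 hq1 k).le
      (le_add_of_nonneg_right (sq_nonneg _)))
    (hasSum_one_sub_mul_pow hq0 hq1).summable

theorem le_qPhaseDeriv (x : ℝ) (k : ℕ) :
    (1 - q) * q ^ k / (1 + ((1 - q) * q ^ k * x) ^ 2) ≤ qPhaseDeriv q x :=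
  (summable_qPhaseDeriv hq0 hq1 x).le_tsum k
    fun k _ => div_nonneg (one_sub_mul_pow_pos hq0 hq1 k).le (by positivity)

theorem qPhaseDeriv_pos (x : ℝ) : 0 < qPhaseDeriv q x :=
  (div_pos (one_sub_mul_pow_pos hq0 hq1 0) (by positivity)).trans_le (le_qPhaseDeriv hq0 hq1 x 0)

theorem exists_le_mul_qPhaseDeriv : ∃ κ, 0 < κ ∧ ∀ x, 1 ≤ x → κ ≤ x * qPhaseDeriv q x := by
  have hc : 0 < 1 - q := by linarith
  refine ⟨(1 - q) * q / (1 + (1 - q) ^ 2), by positivity, fun x hx => ?_⟩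
  have hx0 : 0 < x := by linarith
  -- One term suffices: the one whose index satisfies q ≤ q^(k+1) x < 1.
  obtain ⟨k, hk1, hk2⟩ := exists_nat_pow_near_of_lt_one (inv_pos.2 hx0) (inv_le_one_of_one_le₀ hx)
    hq0 hq1
  refine le_trans ?_ (mul_le_mul_of_nonneg_left (le_qPhaseDeriv hq0 hq1 x (k + 1)) hx0.le)
  have h1 : q ^ (k + 1) * x < 1 := by
    rwa [lt_inv_comm₀ (by positivity) hx0, ← one_div, lt_div_iff₀' (by positivity)] at hk1
  have h2 : q ≤ q ^ (k + 1) * x := by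
    have := (inv_le_iff_one_le_mul₀ hx0).1 hk2
    rw [pow_succ]
    nlinarith
  rw [← mul_div_assoc]
  have h3 : 0 < q ^ (k + 1) * x := by positivity
  refine div_le_div₀ (by positivity) ?_ (by positivity) ?_
  · nlinarith
  · rw [mul_assoc, mul_pow]
    have : (q ^ (k + 1) * x) ^ 2 ≤ 1 := pow_le_one₀ h3.le h1.le
    nlinarith [sq_nonneg (1 - q)]

/-- Points where the phase equals `(n - a) π` grow like `q ^ (-2n)`. -/
theorem sq_le_pow_mul_of_qPhase_eq {a x : ℝ} (ha : a ≤ 1 / 2) {n : ℕ} (hn : 1 ≤ n)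
    (hx : 0 < x) (h : qPhase q x = (n - a) * Real.pi) : 1 ≤ (q ^ 2) ^ (n - 1) * x := by
  obtain ⟨n, rfl⟩ := Nat.exists_eq_add_of_le' hn
  -- After the shift of n, (n + 1 - a)π ≤ nπ + q^(2n) x, and (1 - a)π ≥ π/2 ≥ 1.
  have h1 := qPhase_le_add hq0 hq1 (2 * n) x
  have h2 := qPhase_le_self hq0 hq1 (x := q ^ (2 * n) * x) (by positivity)
  rw [h] at h1
  rw [Nat.add_sub_cancel, ← pow_mul]
  push_cast at h1
  nlinarith [Real.two_le_pi]

/-- With y = q^(2n) x, `add_qPhase_le` forces θ(y) ≤ q/((1-q)² y). Beyond A this fails: the left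
side exceeds θ(1), the right side is below it. -/
theorem exists_pow_mul_le_of_qPhase_eq : ∃ A : ℝ, ∀ (a x : ℝ) (n : ℕ), 0 ≤ a → 0 < x →
    qPhase q x = (n - a) * Real.pi → q ^ (2 * n) * x ≤ A := by
  have hc : 0 < 1 - q := by linarith
  have hp := qPhase_pos hq0 hq1 one_pos
  refine ⟨max 1 (q / ((1 - q) ^ 2 * qPhase q 1)), fun a x n ha hx h => ?_⟩
  by_contra! hcon
  obtain ⟨hy1, hy⟩ := max_lt_iff.1 hcon
  have h1 := add_qPhase_le hq0 hq1 (2 * n) hx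
  have h2 := qPhase_strictMono hq0 hq1 hy1
  generalize q ^ (2 * n) * x = y at *
  have hy0 : 0 < y := by linarith
  rw [div_lt_iff₀ (by positivity)] at hy
  have h3 : q / ((1 - q) ^ 2 * y) < qPhase q 1 := by
    rw [div_lt_iff₀ (by positivity)]
    linarith
  rw [h] at h1
  push_cast at h1
  nlinarith [Real.pi_pos, mul_nonneg ha Real.pi_pos.le]

end

end

/-! ### Polar form of E_q on the imaginary axis, zeros and derivatives. -/

noncomputable section

section

open Complex

theorem one_add_I_mul_eq_norm_mul_exp (y : ℝ) :
    1 + I * y = ‖1 + I * (y : ℂ)‖ * exp (Real.arctan y * I) := by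
  have hs : ‖1 + I * (y : ℂ)‖ = √(1 + y ^ 2) := by
    rw [Complex.norm_def, Complex.normSq_apply]
    congr 1
    simp
    ring
  have h0 : √(1 + y ^ 2) ≠ 0 := by positivity
  rw [hs, exp_mul_I, ← ofReal_cos, ← ofReal_sin, Real.cos_arctan, Real.sin_arctan]
  have h0' : ((√(1 + y ^ 2) : ℝ) : ℂ) ≠ 0 := by exact_mod_cast h0
  push_cast
  field_simp

theorem one_add_I_mul_ne_zero (y : ℝ) : 1 + I * (y : ℂ) ≠ 0 := by
  intro h
  have := congrArg re h
  simp at this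

variable {q : ℝ} (hq0 : 0 < q) (hq1 : q < 1)

theorem qExpE_eq_tprod (z : ℂ) :
    qExpE q z = ∏' k : ℕ, (1 + ((1 - q) * q ^ k : ℝ) * z) := by
  unfold qExpE qPochInf
  congr 1
  ext k
  push_cast
  ring

include hq0 hq1

theorem summable_norm_qExpE_factor (z : ℂ) :
    Summable fun k : ℕ => ‖(((1 - q) * q ^ k : ℝ) : ℂ) * z‖ := by
  refine ((hasSum_one_sub_mul_pow hq0 hq1).summable.mul_right ‖z‖).congr fun k => ?_
  rw [norm_mul, Complex.norm_real, Real.norm_of_nonneg (one_sub_mul_pow_pos hq0 hq1 k).le]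

theorem hasProd_qExpE (z : ℂ) :
    HasProd (fun k : ℕ => 1 + (((1 - q) * q ^ k : ℝ) : ℂ) * z) (qExpE q z) := by
  rw [qExpE_eq_tprod]
  exact (multipliable_one_add_of_summable (summable_norm_qExpE_factor hq0 hq1 z)).hasProd

theorem qExpE_conj (z : ℂ) : qExpE q (starRingEnd ℂ z) = starRingEnd ℂ (qExpE q z) := by
  have h := (hasProd_qExpE hq0 hq1 z).map (starRingEnd ℂ) continuous_conj
  refine (hasProd_qExpE hq0 hq1 _).unique (h.congr_fun ?_)
  intro k
  simp

theorem qExpE_I_mul_ne_zero (x : ℝ) : qExpE q (I * x) ≠ 0 := by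
  rw [qExpE_eq_tprod]
  refine tprod_one_add_ne_zero_of_summable (fun k => ?_) (summable_norm_qExpE_factor hq0 hq1 _)
  have := one_add_I_mul_ne_zero ((1 - q) * q ^ k * x)
  convert! this using 2
  push_cast
  ring

theorem qExpE_I_mul (x : ℝ) :
    qExpE q (I * x) = ‖qExpE q (I * x)‖ * exp (qPhase q x * I) := by
  have h := hasProd_qExpE hq0 hq1 (I * x)
  have h1 := (h.norm).map Complex.ofRealHom Complex.continuous_ofReal
  have h2 := ((Complex.hasSum_ofReal.2 (summable_arctan_qPhase hq0 hq1 x).hasSum).mul_right I).cexp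
  refine h.unique ((h1.mul h2).congr_fun ?_)
  intro k
  have := one_add_I_mul_eq_norm_mul_exp ((1 - q) * q ^ k * x)
  have e : (((1 - q) * q ^ k : ℝ) : ℂ) * (I * x) = I * (((1 - q) * q ^ k * x : ℝ) : ℂ) := by
    push_cast
    ring
  simpa only [Function.comp_apply, Complex.ofRealHom_eq_coe, e] using this

theorem qExpE_neg_I_mul (x : ℝ) :
    qExpE q (-I * x) = ‖qExpE q (I * x)‖ * exp (-qPhase q x * I) := by
  have h := qExpE_conj hq0 hq1 (I * x)
  rw [qExpE_I_mul hq0 hq1 x] at h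
  simpa [← Complex.exp_conj] using h

theorem qSin_ofReal (x : ℝ) :
    qSin q x = (‖qExpE q (I * x)‖ * Real.sin (qPhase q x) : ℝ) := by
  rw [qSin, qExpE_neg_I_mul hq0 hq1, qExpE_I_mul hq0 hq1]
  push_cast
  rw [norm_mul, norm_exp_ofReal_mul_I, exp_mul_I, exp_mul_I, cos_neg, sin_neg]
  simp
  field_simp
  ring

theorem qCos_ofReal (x : ℝ) :
    qCos q x = (‖qExpE q (I * x)‖ * Real.cos (qPhase q x) : ℝ) := by
  rw [qCos, qExpE_neg_I_mul hq0 hq1, qExpE_I_mul hq0 hq1]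
  push_cast
  rw [norm_mul, norm_exp_ofReal_mul_I, exp_mul_I, exp_mul_I, cos_neg, sin_neg]
  simp
  ring

theorem qSin_ofReal_eq_zero_iff {x : ℝ} (hx : 0 < x) :
    qSin q x = 0 ↔ ∃ n : ℕ+, qPhase q x = ((n : ℕ) - 0) * Real.pi := by
  have hp := qPhase_pos hq0 hq1 hx
  have hn := norm_ne_zero_iff.2 (qExpE_I_mul_ne_zero hq0 hq1 x)
  rw [qSin_ofReal hq0 hq1, ofReal_eq_zero, mul_eq_zero, or_iff_right hn, Real.sin_eq_zero_iff]
  constructor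
  · rintro ⟨n, h⟩
    have hn0 : 0 < n := by
      have : (0 : ℝ) < n := by
        by_contra! hle
        nlinarith [Real.pi_pos]
      exact_mod_cast this
    lift n to ℕ using hn0.le
    refine ⟨⟨n, by exact_mod_cast hn0⟩, ?_⟩
    simpa using h.symm
  · rintro ⟨n, h⟩
    exact ⟨n, by rw [h]; simp⟩

theorem qCos_ofReal_eq_zero_iff {x : ℝ} (hx : 0 < x) :
    qCos q x = 0 ↔ ∃ n : ℕ+, qPhase q x = ((n : ℕ) - 1 / 2) * Real.pi := by
  have hp := qPhase_pos hq0 hq1 hx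
  have hn := norm_ne_zero_iff.2 (qExpE_I_mul_ne_zero hq0 hq1 x)
  rw [qCos_ofReal hq0 hq1, ofReal_eq_zero, mul_eq_zero, or_iff_right hn, Real.cos_eq_zero_iff]
  constructor
  · rintro ⟨n, h⟩
    have hn0 : 0 ≤ n := by
      have : (-1 : ℝ) < n := by
        by_contra! hle
        nlinarith [Real.pi_pos]
      have : (-1 : ℤ) < n := by exact_mod_cast this
      omega
    lift n to ℕ using hn0
    -- `Real.cos_eq_zero_iff` counts from 0: (2n + 1)π/2 = ((n + 1) - 1/2)π.
    refine ⟨⟨n + 1, n.succ_pos⟩, ?_⟩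
    rw [h, PNat.mk_coe]
    push_cast
    ring
  · rintro ⟨n, h⟩
    refine ⟨(n : ℤ) - 1, ?_⟩
    rw [h]
    push_cast
    ring

theorem summable_logDeriv_qExpE_factor (w : ℂ) :
    Summable fun k : ℕ => (((1 - q) * q ^ k : ℝ) : ℂ) / (1 + (((1 - q) * q ^ k : ℝ) : ℂ) * w) := by
  have hcc : Summable fun k : ℕ => (((1 - q) * q ^ k : ℝ) : ℂ) :=
    Complex.summable_ofReal.2 (hasSum_one_sub_mul_pow hq0 hq1).summable
  have htend : Filter.Tendsto (fun k : ℕ => (1 + (((1 - q) * q ^ k : ℝ) : ℂ) * w)⁻¹)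
      Filter.atTop (nhds 1) := by
    have := ((hcc.tendsto_atTop_zero.mul_const w).const_add 1).inv₀ (by simp)
    simpa using this
  refine summable_of_isBigO_nat (g := fun k : ℕ => (1 - q) * q ^ k)
    (hasSum_one_sub_mul_pow hq0 hq1).summable ?_
  have h1 : (fun k : ℕ => (((1 - q) * q ^ k : ℝ) : ℂ)) =O[Filter.atTop]
      fun k : ℕ => (1 - q) * q ^ k :=
    Asymptotics.IsBigO.of_norm_eventuallyLE (Filter.Eventually.of_forall fun k => by
      simp only [Complex.norm_real]
      rw [Real.norm_of_nonneg (one_sub_mul_pow_pos hq0 hq1 k).le])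
  simpa only [div_eq_mul_inv, mul_one] using h1.mul (htend.isBigO_one ℝ)

theorem hasDerivAt_qExpE {w : ℂ} (hw : ∀ k : ℕ, 1 + (((1 - q) * q ^ k : ℝ) : ℂ) * w ≠ 0) :
    HasDerivAt (qExpE q)
      (qExpE q w * ∑' k : ℕ, ((1 - q) * q ^ k : ℝ) / (1 + (((1 - q) * q ^ k : ℝ) : ℂ) * w)) w := by
  set f : ℕ → ℂ → ℂ := fun k z => (((1 - q) * q ^ k : ℝ) : ℂ) * z with hf
  have hball : w ∈ Metric.ball (0 : ℂ) (‖w‖ + 1) := by simp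
  have hE : qExpE q = fun z => ∏' k, (1 + f k z) := funext fun z => qExpE_eq_tprod z
  have hlu : HasProdLocallyUniformlyOn (fun k z => 1 + f k z) (fun z => ∏' k, (1 + f k z))
      (Metric.ball (0 : ℂ) (‖w‖ + 1)) := by
    refine Summable.hasProdLocallyUniformlyOn_nat_one_add Metric.isOpen_ball
      ((hasSum_one_sub_mul_pow hq0 hq1).summable.mul_right (‖w‖ + 1))
      (Filter.Eventually.of_forall fun k z hz => ?_) (fun k => by fun_prop)
    rw [hf, norm_mul, Complex.norm_real, Real.norm_of_nonneg (one_sub_mul_pow_pos hq0 hq1 k).le]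
    exact mul_le_mul_of_nonneg_left (mem_ball_zero_iff.1 hz).le (one_sub_mul_pow_pos hq0 hq1 k).le
  have hd : ∀ k, DifferentiableOn ℂ (fun z => 1 + f k z) (Metric.ball (0 : ℂ) (‖w‖ + 1)) :=
    fun k => by fun_prop
  have hdiff : DifferentiableAt ℂ (qExpE q) w := by
    rw [hE]
    refine (TendstoLocallyUniformlyOn.differentiableOn
      (hasProdLocallyUniformlyOn_iff_tendstoLocallyUniformlyOn.1 hlu)
      (Filter.Eventually.of_forall fun s => ?_) Metric.isOpen_ball).differentiableAt
      (Metric.isOpen_ball.mem_nhds hball)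
    exact DifferentiableOn.fun_finsetProd fun k _ => hd k
  have hnz : qExpE q w ≠ 0 := by
    rw [qExpE_eq_tprod]
    exact tprod_one_add_ne_zero_of_summable hw (summable_norm_qExpE_factor hq0 hq1 w)
  have hlog : ∀ k, logDeriv (fun z => 1 + f k z) w =
      ((1 - q) * q ^ k : ℝ) / (1 + (((1 - q) * q ^ k : ℝ) : ℂ) * w) := fun k => by
    rw [logDeriv_apply]
    congr 1
    have := ((hasDerivAt_id w).const_mul (((1 - q) * q ^ k : ℝ) : ℂ)).const_add 1
    simpa only [id_eq, mul_one] using this.deriv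
  have hsum : Summable fun k => logDeriv (fun z => 1 + f k z) w := by
    simp_rw [hlog]
    exact summable_logDeriv_qExpE_factor hq0 hq1 w
  have key := logDeriv_tprod_eq_tsum Metric.isOpen_ball hball (f := fun k z => 1 + f k z) hw hd
    hsum hlu.multipliableLocallyUniformlyOn (by rw [← qExpE_eq_tprod]; exact hnz)
  rw [← hE, logDeriv_apply, div_eq_iff hnz] at key
  simp_rw [hlog] at key
  rw [mul_comm, ← key]
  exact hdiff.hasDerivAt

/-- At a real point `x`, `E_q(iz)` and `E_q(-iz)` have conjugate logarithmic derivatives, with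
imaginary parts `±qPhaseDeriv q x`. -/
theorem exists_hasDerivAt_qExpE_I_mul (x : ℝ) : ∃ S : ℂ, S + starRingEnd ℂ S = 2 * qPhaseDeriv q x ∧
    HasDerivAt (fun z => qExpE q (I * z)) (qExpE q (I * x) * S * I) x ∧
    HasDerivAt (fun z => qExpE q (-I * z)) (qExpE q (-I * x) * starRingEnd ℂ S * -I) x := by
  have hne : ∀ (y : ℝ) (k : ℕ), 1 + (((1 - q) * q ^ k : ℝ) : ℂ) * (I * y) ≠ 0 := fun y k => by
    convert! one_add_I_mul_ne_zero ((1 - q) * q ^ k * y) using 2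
    push_cast
    ring
  have hx : ((-x : ℝ) : ℂ) = -x := by push_cast; rfl
  refine ⟨∑' k : ℕ, ((1 - q) * q ^ k : ℝ) / (1 + (((1 - q) * q ^ k : ℝ) : ℂ) * (I * x)),
    ?_, ?_, ?_⟩
  · have e : ∀ k : ℕ, ((((1 - q) * q ^ k : ℝ) : ℂ) /
        (1 + (((1 - q) * q ^ k : ℝ) : ℂ) * (I * x))).re =
        (1 - q) * q ^ k / (1 + ((1 - q) * q ^ k * x) ^ 2) := fun k => by
      generalize (1 - q) * q ^ k = c
      simp [Complex.div_re, Complex.normSq_apply]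
      ring
    rw [Complex.add_conj, Complex.re_tsum (summable_logDeriv_qExpE_factor hq0 hq1 _), qPhaseDeriv]
    simp_rw [e]
    push_cast
    rfl
  · have h1 : HasDerivAt (fun z : ℂ => I * z) I x := by
      simpa using (hasDerivAt_id (x : ℂ)).const_mul I
    exact (hasDerivAt_qExpE hq0 hq1 (hne x)).comp (x : ℂ) h1
  · have h1 : HasDerivAt (fun z : ℂ => -I * z) (-I) x := by
      simpa using (hasDerivAt_id (x : ℂ)).const_mul (-I)
    have h2 := hasDerivAt_qExpE hq0 hq1 (hne (-x))
    rw [hx, mul_neg, ← neg_mul] at h2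
    have e : (starRingEnd ℂ) (∑' k : ℕ, (((1 - q) * q ^ k : ℝ) : ℂ) /
        (1 + (((1 - q) * q ^ k : ℝ) : ℂ) * (I * x))) = ∑' k : ℕ, (((1 - q) * q ^ k : ℝ) : ℂ) /
        (1 + (((1 - q) * q ^ k : ℝ) : ℂ) * (-I * x)) := by
      rw [Complex.conj_tsum]
      congr 1
      ext k
      simp
    rw [e]
    exact h2.comp (x : ℂ) h1

/-- At a zero E_q(-ix) = E_q(ix), so the conjugate logarithmic derivatives add up to 2θ'; the common
factor E_q(ix) cancels against Cos_q x. -/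
theorem deriv_qSin_of_eq_zero {x : ℝ} (h : qSin q x = 0) :
    deriv (qSin q) x ≠ 0 ∧ qCos q x / deriv (qSin q) x = (qPhaseDeriv q x : ℂ)⁻¹ := by
  obtain ⟨S, hS, h1, h2⟩ := exists_hasDerivAt_qExpE_I_mul hq0 hq1 x
  have hF := qExpE_I_mul_ne_zero hq0 hq1 x
  have hT : (qPhaseDeriv q x : ℂ) ≠ 0 := by exact_mod_cast (qPhaseDeriv_pos hq0 hq1 x).ne'
  have hd : HasDerivAt (qSin q) _ x := (h1.sub h2).div_const (2 * I)
  have hG : qExpE q (-I * x) = qExpE q (I * x) := by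
    rw [qSin, div_eq_zero_iff, or_iff_left (by simp), sub_eq_zero] at h
    exact h.symm
  have e : deriv (qSin q) x = qExpE q (I * x) * qPhaseDeriv q x := by
    rw [hd.deriv, hG, div_eq_iff (by simp)]
    linear_combination qExpE q (I * x) * I * hS
  rw [e, qCos, hG]
  refine ⟨mul_ne_zero hF hT, ?_⟩
  field_simp
  ring

/-- Now E_q(-ix) = -E_q(ix); the extra factors of i produce the minus sign. -/
theorem deriv_qCos_of_eq_zero {x : ℝ} (h : qCos q x = 0) :
    deriv (qCos q) x ≠ 0 ∧ qSin q x / deriv (qCos q) x = -(qPhaseDeriv q x : ℂ)⁻¹ := by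
  obtain ⟨S, hS, h1, h2⟩ := exists_hasDerivAt_qExpE_I_mul hq0 hq1 x
  have hF := qExpE_I_mul_ne_zero hq0 hq1 x
  have hT : (qPhaseDeriv q x : ℂ) ≠ 0 := by exact_mod_cast (qPhaseDeriv_pos hq0 hq1 x).ne'
  have hd : HasDerivAt (qCos q) _ x := (h1.add h2).div_const 2
  have hG : qExpE q (-I * x) = -qExpE q (I * x) := by
    rw [qCos, div_eq_zero_iff, or_iff_left (by simp), add_comm] at h
    exact eq_neg_of_add_eq_zero_left h
  have e : deriv (qCos q) x = qExpE q (I * x) * I * qPhaseDeriv q x := by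
    rw [hd.deriv, hG, div_eq_iff (by simp)]
    linear_combination qExpE q (I * x) * I * hS
  rw [e, qSin, hG]
  refine ⟨mul_ne_zero (mul_ne_zero hF I_ne_zero) hT, ?_⟩
  field_simp
  rw [I_sq]
  ring

end

end

/-! ### Enumeration of the zeros and the final estimates. -/

noncomputable section

section

variable {q : ℝ} (hq0 : 0 < q) (hq1 : q < 1)
include hq0 hq1

/-- If the positive zeros of `f` are the points where the phase is `(n - a) π`, they form an
increasing sequence. -/
theorem exists_isPosZeroSeq {f : ℂ → ℂ} {a : ℝ} (ha : a ≤ 1 / 2)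
    (hf : ∀ x : ℝ, 0 < x → (f x = 0 ↔ ∃ n : ℕ+, qPhase q x = ((n : ℕ) - a) * Real.pi)) :
    ∃ ξ : ℕ+ → ℝ, IsPosZeroSeq f ξ ∧ ∀ n, qPhase q (ξ n) = ((n : ℕ) - a) * Real.pi := by
  have hpos : ∀ n : ℕ+, 0 < ((n : ℕ) - a) * Real.pi := fun n => by
    have : (1 : ℝ) ≤ (n : ℕ) := by exact_mod_cast n.pos
    exact mul_pos (by linarith) Real.pi_pos
  choose ξ h0 h using fun n => exists_qPhase_eq hq0 hq1 (hpos n)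
  have hmono := qPhase_strictMono hq0 hq1
  refine ⟨ξ, ⟨fun m n hmn => ?_, Set.ext fun x => ⟨?_, ?_⟩⟩, h⟩
  · rw [← hmono.lt_iff_lt, h, h]
    have : ((m : ℕ) : ℝ) < (n : ℕ) := by exact_mod_cast hmn
    exact mul_lt_mul_of_pos_right (by linarith) Real.pi_pos
  · rintro ⟨n, rfl⟩
    exact ⟨h0 n, (hf _ (h0 n)).2 ⟨n, h n⟩⟩
  · rintro ⟨hx, hfx⟩
    obtain ⟨n, hn⟩ := (hf x hx).1 hfx
    exact ⟨n, hmono.injective ((h n).trans hn.symm)⟩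

omit hq0 hq1 in
theorem IsPosZeroSeq.unique {f : ℂ → ℂ} {x y : ℕ+ → ℝ} (hx : IsPosZeroSeq f x)
    (hy : IsPosZeroSeq f y) : x = y :=
  (hx.1.range_inj hy.1).1 (hx.2.trans hy.2.symm)

/-- Boundedness and absolute convergence for residues of modulus `1 / qPhaseDeriv q`. -/
theorem bounded_and_summable_of_qPhase_eq {a : ℝ} (ha0 : 0 ≤ a) (ha : a ≤ 1 / 2) {ξ : ℕ+ → ℝ}
    (h0 : ∀ n, 0 < ξ n) (h : ∀ n, qPhase q (ξ n) = ((n : ℕ) - a) * Real.pi) {r : ℕ+ → ℂ}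
    (hr : ∀ n, ‖r n‖ = (qPhaseDeriv q (ξ n))⁻¹) :
    (∃ C : ℝ, ∀ n : ℕ+, ‖(q : ℂ) ^ (2 * (n : ℕ)) * r n‖ ≤ C) ∧
    ∀ s : ℂ, 1 < s.re → Summable fun n : ℕ+ => ‖r n * (1 / (ξ n : ℂ) ^ s)‖ := by
  obtain ⟨κ, hκ, hle⟩ := exists_le_mul_qPhaseDeriv hq0 hq1
  obtain ⟨A, hA⟩ := exists_pow_mul_le_of_qPhase_eq hq0 hq1
  have hlow : ∀ n : ℕ+, 1 ≤ (q ^ 2) ^ ((n : ℕ) - 1) * ξ n := fun n =>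
    sq_le_pow_mul_of_qPhase_eq hq0 hq1 ha n.pos (h0 n) (h n)
  have h1 : ∀ n, 1 ≤ ξ n := fun n => (hlow n).trans
    (mul_le_of_le_one_left (h0 n).le (pow_le_one₀ (by positivity) (pow_le_one₀ hq0.le hq1.le)))
  have hr' : ∀ n, ‖r n‖ ≤ ξ n / κ := fun n => by
    have := qPhaseDeriv_pos hq0 hq1 (ξ n)
    rw [hr, inv_le_iff_one_le_mul₀ this, div_mul_eq_mul_div, le_div_iff₀ hκ, one_mul]
    exact hle _ (h1 n)
  refine ⟨⟨A / κ, fun n => ?_⟩, fun s hs => ?_⟩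
  · rw [norm_mul, norm_pow, Complex.norm_real, Real.norm_of_nonneg hq0.le]
    calc q ^ (2 * (n : ℕ)) * ‖r n‖ ≤ q ^ (2 * (n : ℕ)) * (ξ n / κ) :=
          mul_le_mul_of_nonneg_left (hr' n) (by positivity)
      _ = q ^ (2 * (n : ℕ)) * ξ n / κ := by ring
      _ ≤ A / κ := div_le_div_of_nonneg_right (hA a (ξ n) n ha0 (h0 n) (h n)) hκ.le
  · have hs' : 0 < s.re - 1 := by linarith
    -- The terms are at most ξ_n^(1 - Re s)/κ, and ξ_n ≥ q^(-2(n-1)).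
    have hsum : Summable fun n : ℕ+ => ((q ^ 2) ^ (s.re - 1)) ^ ((n : ℕ) - 1) / κ := by
      refine Summable.div_const ?_ κ
      rw [← Equiv.summable_iff Equiv.pnatEquivNat.symm]
      refine (summable_geometric_of_lt_one (r := (q ^ 2) ^ (s.re - 1)) (by positivity)
        (Real.rpow_lt_one (by positivity) (pow_lt_one₀ hq0.le hq1 two_ne_zero) hs')).congr
        fun n => ?_
      simp
    refine Summable.of_nonneg_of_le (fun n => norm_nonneg _) (fun n => ?_) hsum
    rw [norm_mul, norm_div, norm_one, Complex.norm_cpow_eq_rpow_re_of_pos (h0 n)]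
    calc ‖r n‖ * (1 / ξ n ^ s.re) ≤ ξ n / κ * (1 / ξ n ^ s.re) :=
          mul_le_mul_of_nonneg_right (hr' n) (by have := h0 n; positivity)
      _ = (ξ n)⁻¹ ^ (s.re - 1) / κ := by
          rw [Real.inv_rpow (h0 n).le, Real.rpow_sub_one (h0 n).ne']
          have := h0 n
          field_simp
      _ ≤ ((q ^ 2) ^ ((n : ℕ) - 1)) ^ (s.re - 1) / κ := by
          refine div_le_div_of_nonneg_right (Real.rpow_le_rpow (inv_nonneg.2 (h0 n).le) ?_ hs'.le)
            hκ.le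
          exact (inv_le_iff_one_le_mul₀ (h0 n)).2 (hlow n)
      _ = ((q ^ 2) ^ (s.re - 1)) ^ ((n : ℕ) - 1) / κ := by
          rw [Real.rpow_pow_comm (by positivity)]

end

end
theorem mainTheorem12 (q : ℝ) (hq0 : 0 < q) (hq1 : q < 1) :
    -- the positive zeros of `Sin_q` and of `Cos_q` form infinite increasing sequences
    (∃ ξ : ℕ+ → ℝ, IsPosZeroSeq (qSin q) ξ) ∧
    (∃ η : ℕ+ → ℝ, IsPosZeroSeq (qCos q) η) ∧
    ∀ ξ η : ℕ+ → ℝ, IsPosZeroSeq (qSin q) ξ → IsPosZeroSeq (qCos q) η →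
      -- the denominators do not vanish
      (∀ n : ℕ+, deriv (qSin q) (ξ n) ≠ 0) ∧
      (∀ n : ℕ+, deriv (qCos q) (η n) ≠ 0) ∧
      -- the two sequences are bounded
      (∃ C : ℝ, ∀ n : ℕ+,
        ‖(q : ℂ) ^ (2 * (n : ℕ)) * (qCos q (ξ n) / deriv (qSin q) (ξ n))‖ ≤ C) ∧
      (∃ C : ℝ, ∀ n : ℕ+,
        ‖(q : ℂ) ^ (2 * (n : ℕ)) * (qSin q (η n) / deriv (qCos q) (η n))‖ ≤ C) ∧
      -- the series of `ζ_q` and `ζ_q^*` converge absolutely for `Re s > 1`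
      (∀ s : ℂ, 1 < s.re →
        Summable fun n : ℕ+ =>
          ‖qCos q (ξ n) / deriv (qSin q) (ξ n) * (1 / (ξ n : ℂ) ^ s)‖) ∧
      (∀ s : ℂ, 1 < s.re →
        Summable fun n : ℕ+ =>
          ‖qSin q (η n) / deriv (qCos q) (η n) * (1 / (η n : ℂ) ^ s)‖) := by
  obtain ⟨ξ₀, hξ₀, hξp⟩ := exists_isPosZeroSeq hq0 hq1 (a := 0) (by norm_num)
    fun x hx => qSin_ofReal_eq_zero_iff hq0 hq1 hx
  obtain ⟨η₀, hη₀, hηp⟩ := exists_isPosZeroSeq hq0 hq1 (a := 1 / 2) le_rfl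
    fun x hx => qCos_ofReal_eq_zero_iff hq0 hq1 hx
  refine ⟨⟨ξ₀, hξ₀⟩, ⟨η₀, hη₀⟩, fun ξ η hξ hη => ?_⟩
  -- An increasing enumeration is determined by its range, so any given one inherits the phase
  -- values.
  obtain rfl := hξ.unique hξ₀
  obtain rfl := hη.unique hη₀
  have hξz : ∀ n, 0 < ξ n ∧ qSin q (ξ n) = 0 := fun n => hξ.2.subset (Set.mem_range_self n)
  have hηz : ∀ n, 0 < η n ∧ qCos q (η n) = 0 := fun n => hη.2.subset (Set.mem_range_self n)
  have hξd := fun n => deriv_qSin_of_eq_zero hq0 hq1 (hξz n).2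
  have hηd := fun n => deriv_qCos_of_eq_zero hq0 hq1 (hηz n).2
  obtain ⟨hξb, hξs⟩ := bounded_and_summable_of_qPhase_eq hq0 hq1 le_rfl (by norm_num)
    (fun n => (hξz n).1) hξp (r := fun n => qCos q (ξ n) / deriv (qSin q) (ξ n)) fun n => by
      rw [(hξd n).2, norm_inv, Complex.norm_real,
        Real.norm_of_nonneg (qPhaseDeriv_pos hq0 hq1 _).le]
  obtain ⟨hηb, hηs⟩ := bounded_and_summable_of_qPhase_eq hq0 hq1 (by norm_num) le_rfl
    (fun n => (hηz n).1) hηp (r := fun n => qSin q (η n) / deriv (qCos q) (η n)) fun n => by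
      rw [(hηd n).2, norm_neg, norm_inv, Complex.norm_real,
        Real.norm_of_nonneg (qPhaseDeriv_pos hq0 hq1 _).le]
  exact ⟨fun n => (hξd n).1, fun n => (hηd n).1, hξb, hηb, hξs, hηs⟩
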